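/- Let $p$ be a prime, let $d\ge 2$, and let $F$ be the free metabelian pro-$p$ group on generators $g_1,\dots,g_d$. Let $A=F'$ be the derived subgroup of $F$ (the closed subgroup generated by all commutators), put $x_i=g_iF'$ and $X=F/F'$, and let $R=\mathbb{Z}_p[[X]]=\varprojlim_{n,N}(\mathbb{Z}/p^n)[X/N]$ (where $n\in\mathbb{N}$ and $N$ runs over the open subgroups of $X$) be the completed group algebra of $X$. Write $A$ additively and regard it as an $R$-module through the continuous extension to $R$ of the conjugation action $a\cdot gF'=g^{-1}ag$ of $X$ on $A$. Put $\xi_d=x_d-1\in R$ and $u_{id}=[g_i,g_d]=g_i^{-1}g_d^{-1}g_ig_d\in A$ for $1\le i\le d-1$. Then the map $a\mapsto a\xi_d$ is an isomorphism of $R$-modules from $A$ onto $A\xi_d$, the elements $u_{1d},\dots,u_{d-1,d}$ are linearly independent over $R$ (so that the sum $\sum_{i=1}^{d-1}u_{id}R$ is direct and is a free $R$-module of rank $d-1$), and $$A\xi_d\ \le\ \bigoplus_{i=1}^{d-1}u_{id}R .$$ -/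

import Mathlib

open Topology

universe u

/-- A profinite (compact, Hausdorff, totally disconnected) group `G` is pro-`p` if every open
normal subgroup of `G` has index a power of `p`. -/
class IsProP (p : ℕ) (G : Type*) [Group G] [TopologicalSpace G] [IsTopologicalGroup G]
    [CompactSpace G] [T2Space G] [TotallyDisconnectedSpace G] : Prop where
  index_eq_pow : ∀ N : OpenNormalSubgroup G, ∃ k : ℕ, N.toSubgroup.index = p ^ k

/-- A metabelian group: the commutator subgroup is abelian. -/
class IsMetabelianGroup (G : Type*) [Group G] : Prop where
  commute : ∀ a ∈ commutator G, ∀ b ∈ commutator G, a * b = b * a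

/-- The metabelian pro-`p` group `F` is free, as such, on the finite family `g`: every map from
the family to a metabelian pro-`p` group extends uniquely to a continuous homomorphism. -/
structure IsFreeMetabelianProP (p : ℕ) {ι : Type*} [Finite ι] {F : Type u} [Group F]
    [TopologicalSpace F] [IsTopologicalGroup F] [CompactSpace F] [T2Space F]
    [TotallyDisconnectedSpace F] [IsProP p F] [IsMetabelianGroup F] (g : ι → F) : Prop where
  existsUnique_lift : ∀ (G : Type u) [Group G] [TopologicalSpace G] [IsTopologicalGroup G]
    [CompactSpace G] [T2Space G] [TotallyDisconnectedSpace G] [IsProP p G] [IsMetabelianGroup G]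
    (h : ι → G), ∃! φ : F →ₜ* G, ∀ i, φ (g i) = h i

noncomputable section

/-! ### The completed group algebra `ℤ_p[[X]]` -/

section CompletedGroupAlgebra

variable (p : ℕ) (X : Type*) [CommGroup X] [TopologicalSpace X]

/-- The finite-level group ring `(ℤ/pⁿ)[X/N]`. -/
abbrev LevelAlgebra (i : ℕ × OpenNormalSubgroup X) : Type _ :=
  MonoidAlgebra (ZMod (p ^ i.1)) (X ⧸ i.2.toSubgroup)

variable {X}

/-- The natural map `(ℤ/pᵐ)[X/M] → (ℤ/pⁿ)[X/N]` for `n ≤ m` and `M ≤ N`. -/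
def levelMap {i j : ℕ × OpenNormalSubgroup X} (hn : i.1 ≤ j.1) (hN : j.2 ≤ i.2) :
    LevelAlgebra p X j →+* LevelAlgebra p X i :=
  (MonoidAlgebra.mapRingHom _ (ZMod.castHom (pow_dvd_pow p hn) (ZMod (p ^ i.1)))).comp
    (MonoidAlgebra.mapDomainRingHom _
      (QuotientGroup.map j.2.toSubgroup i.2.toSubgroup (MonoidHom.id X) hN))

variable (X)

/-- The inverse limit of the rings `(ℤ/pⁿ)[X/N]`, over `n` and the open normal subgroups `N`
of `X`, inside their product. -/
def completedGroupAlgebraSubring : Subring (∀ i : ℕ × OpenNormalSubgroup X, LevelAlgebra p X i) where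
  carrier := {r | ∀ (i j : ℕ × OpenNormalSubgroup X) (hn : i.1 ≤ j.1) (hN : j.2 ≤ i.2),
    levelMap p hn hN (r j) = r i}
  mul_mem' hr hs i j hn hN := by
    rw [Pi.mul_apply, Pi.mul_apply, map_mul, hr i j hn hN, hs i j hn hN]
  one_mem' i j hn hN := by rw [Pi.one_apply, Pi.one_apply, map_one]
  add_mem' hr hs i j hn hN := by
    rw [Pi.add_apply, Pi.add_apply, map_add, hr i j hn hN, hs i j hn hN]
  zero_mem' i j hn hN := by rw [Pi.zero_apply, Pi.zero_apply, map_zero]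
  neg_mem' hr i j hn hN := by rw [Pi.neg_apply, Pi.neg_apply, map_neg, hr i j hn hN]

/-- The completed group algebra `ℤ_p[[X]]`. -/
abbrev CompletedGroupAlgebra : Type _ := completedGroupAlgebraSubring p X

variable {X}

/-- The natural map `ℤ[X] → (ℤ/pⁿ)[X/N]`. -/
def toLevel (i : ℕ × OpenNormalSubgroup X) : MonoidAlgebra ℤ X →+* LevelAlgebra p X i :=
  (MonoidAlgebra.mapRingHom _ (Int.castRingHom (ZMod (p ^ i.1)))).comp
    (MonoidAlgebra.mapDomainRingHom _ (QuotientGroup.mk' i.2.toSubgroup))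

lemma levelMap_toLevel {i j : ℕ × OpenNormalSubgroup X} (hn : i.1 ≤ j.1) (hN : j.2 ≤ i.2)
    (s : MonoidAlgebra ℤ X) : levelMap p hn hN (toLevel p j s) = toLevel p i s := by
  have : (levelMap p hn hN).comp (toLevel p j) = toLevel p i := by
    ext x
    · simp
    · have h1 : (QuotientGroup.map j.2.toSubgroup i.2.toSubgroup (MonoidHom.id X) hN)
          (QuotientGroup.mk x) = QuotientGroup.mk x := rfl
      simp only [levelMap, toLevel, MonoidHom.coe_comp, MonoidHom.coe_coe, RingHom.coe_comp,
        Function.comp_apply, MonoidAlgebra.of_apply, MonoidAlgebra.mapDomainRingHom_apply,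
        MonoidAlgebra.mapDomain_single, MonoidAlgebra.mapRingHom_single, map_one,
        QuotientGroup.mk'_apply, h1]
  exact DFunLike.congr_fun this s

/-- The natural map `ℤ[X] → ℤ_p[[X]]`. -/
def toCompleted : MonoidAlgebra ℤ X →+* CompletedGroupAlgebra p X :=
  (RingHom.pi fun i => toLevel p i).codRestrict (completedGroupAlgebraSubring p X)
    fun s _ _ hn hN => levelMap_toLevel p hn hN s

/-- The group elements `x ∈ X`, as elements of `ℤ_p[[X]]`. -/
def CompletedGroupAlgebra.of : X →* CompletedGroupAlgebra p X :=
  (toCompleted p).toMonoidHom.comp (MonoidAlgebra.of ℤ X)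

end CompletedGroupAlgebra

/-! ### The module structure over `ℤ_p[[X]]` -/

section ModuleStructure

section GroupRing

variable {X A : Type*} [CommGroup X] [AddCommGroup A] [DistribMulAction X A]

/-- The action of the abstract group ring `ℤ[X]` on an `X`-module. -/
def groupRingAct : MonoidAlgebra ℤ X →+* AddMonoid.End A :=
  (MonoidAlgebra.lift ℤ (AddMonoid.End A) X
    (DistribMulAction.toAddMonoidEnd X A)).toRingHom

lemma groupRingAct_single (x : X) (n : ℤ) (a : A) :
    groupRingAct (MonoidAlgebra.single x n) a = n • x • a := by
  have h : groupRingAct (MonoidAlgebra.single x n) =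
      n • DistribMulAction.toAddMonoidEnd X A x := by simp [groupRingAct]
  rw [h]
  rfl

lemma groupRingAct_add (s t : MonoidAlgebra ℤ X) (a : A) :
    groupRingAct (s + t) a = groupRingAct s a + groupRingAct t a := by
  rw [map_add]
  rfl

lemma groupRingAct_mul (s t : MonoidAlgebra ℤ X) (a : A) :
    groupRingAct (s * t) a = groupRingAct s (groupRingAct t a) := by
  rw [map_mul]
  rfl

lemma groupRingAct_mem {U : AddSubgroup A} (hU : ∀ (x : X), ∀ a ∈ U, x • a ∈ U)
    (s : MonoidAlgebra ℤ X) {a : A} (ha : a ∈ U) : groupRingAct s a ∈ U := by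
  induction s using MonoidAlgebra.induction_linear with
  | zero => simp
  | add f g hf hg => rw [groupRingAct_add]; exact U.add_mem hf hg
  | single x c => rw [groupRingAct_single]; exact U.zsmul_mem (hU x a ha) c

end GroupRing

variable (p : ℕ) (X A : Type*) [CommGroup X] [TopologicalSpace X] [AddCommGroup A]
  [TopologicalSpace A] [DistribMulAction X A]

/-- A pro-`p` `X`-module: the open `X`-invariant subgroups `U` such that `A / U` has `p`-power
exponent and such that some open subgroup of `X` acts trivially on `A / U` form a neighbourhood
base of `0`. -/
class IsProPModule : Prop where
  exists_subgroup : ∀ V ∈ 𝓝 (0 : A), ∃ U : AddSubgroup A, IsOpen (U : Set A) ∧ (U : Set A) ⊆ V ∧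
    (∀ (x : X), ∀ a ∈ U, x • a ∈ U) ∧ (∃ n : ℕ, ∀ a : A, p ^ n • a ∈ U) ∧
    ∃ N : OpenNormalSubgroup X, ∀ x ∈ N, ∀ a : A, x • a - a ∈ U

variable {X A}

/-- `b = r • a` for `r ∈ ℤ_p[[X]]`: the element `b` is the limit of the elements `s • a`, for
`s ∈ ℤ[X]` converging to `r` in `ℤ_p[[X]]`. -/
def IsLimitSMul (r : CompletedGroupAlgebra p X) (a b : A) : Prop :=
  ∀ V ∈ 𝓝 (0 : A), ∃ i : ℕ × OpenNormalSubgroup X, ∀ s : MonoidAlgebra ℤ X,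
    toLevel p i s = r.1 i → b - groupRingAct s a ∈ V

lemma toLevel_eq_of_le {i j : ℕ × OpenNormalSubgroup X} (hn : i.1 ≤ j.1) (hN : j.2 ≤ i.2)
    {r : CompletedGroupAlgebra p X} {s : MonoidAlgebra ℤ X} (h : toLevel p j s = r.1 j) :
    toLevel p i s = r.1 i := by
  rw [← levelMap_toLevel p hn hN, h, r.2 i j hn hN]

lemma toLevel_surjective (i : ℕ × OpenNormalSubgroup X) :
    Function.Surjective (toLevel (X := X) p i) := by
  intro t
  induction t using MonoidAlgebra.induction_linear with
  | zero => exact ⟨0, map_zero _⟩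
  | add f g hf hg =>
    obtain ⟨s, rfl⟩ := hf
    obtain ⟨t, rfl⟩ := hg
    exact ⟨s + t, map_add _ _ _⟩
  | single x c =>
    obtain ⟨x, rfl⟩ := QuotientGroup.mk_surjective x
    obtain ⟨c, rfl⟩ := ZMod.intCast_surjective c
    exact ⟨MonoidAlgebra.single x c, by simp [toLevel]⟩

lemma groupRingAct_mem_of_toLevel_eq_zero {U : AddSubgroup A}
    (hU : ∀ (x : X), ∀ a ∈ U, x • a ∈ U) {n : ℕ} (hn : ∀ a : A, p ^ n • a ∈ U)
    {N : OpenNormalSubgroup X} (hN : ∀ x ∈ N, ∀ a : A, x • a - a ∈ U)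
    {s : MonoidAlgebra ℤ X} (hs : toLevel p (n, N) s = 0) (a : A) : groupRingAct s a ∈ U := by
  classical
  let φ : (X ⧸ N.toSubgroup →₀ ℤ) →+ A :=
    Finsupp.liftAddHom fun c => (zmultiplesHom A) (Quotient.out c • a)
  let π : MonoidAlgebra ℤ X →+* MonoidAlgebra ℤ (X ⧸ N.toSubgroup) :=
    MonoidAlgebra.mapDomainRingHom ℤ (QuotientGroup.mk' N.toSubgroup)
  have h1 : ∀ s : MonoidAlgebra ℤ X, groupRingAct s a - φ (π s).coeff ∈ U := by
    intro s
    induction s using MonoidAlgebra.induction_linear with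
    | zero => simp
    | add f g hf hg =>
      have := U.add_mem hf hg
      rw [groupRingAct_add, map_add, MonoidAlgebra.coeff_add, map_add]
      convert this using 1
      abel
    | single x c =>
      have hx : (Quotient.out (QuotientGroup.mk x : X ⧸ N.toSubgroup))⁻¹ * x ∈ N := by
        have := QuotientGroup.out_eq' (QuotientGroup.mk x : X ⧸ N.toSubgroup)
        exact QuotientGroup.eq.mp this
      have h2 := hU (Quotient.out (QuotientGroup.mk x : X ⧸ N.toSubgroup)) _ (hN _ hx a)
      rw [smul_sub, smul_smul, mul_inv_cancel_left] at h2
      have h3 : φ (π (MonoidAlgebra.single x c)).coeff =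
          c • (Quotient.out (QuotientGroup.mk x : X ⧸ N.toSubgroup) • a) := by
        simp [φ, π]
      rw [groupRingAct_single, h3, ← smul_sub]
      exact U.zsmul_mem h2 c
  have h4 : ∀ c, ((p ^ n : ℕ) : ℤ) ∣ (π s).coeff c := by
    intro c
    rw [← ZMod.intCast_zmod_eq_zero_iff_dvd] 
    have : (toLevel p (n, N) s).coeff c = 0 := by rw [hs]; rfl
    simpa [toLevel, π] using this
  have h5 : φ (π s).coeff ∈ U := by
    simp only [φ, Finsupp.liftAddHom_apply]
    refine U.sum_mem fun c _ => ?_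
    obtain ⟨k, hk⟩ := h4 c
    rw [hk]
    have := U.zsmul_mem (hn (Quotient.out c • a)) k
    rw [← natCast_zsmul, smul_smul, mul_comm] at this
    simpa using this
  simpa using U.add_mem (h1 s) h5

lemma IsLimitSMul.exists_approx {r : CompletedGroupAlgebra p X} {a b : A}
    (hb : IsLimitSMul p r a b) {U : AddSubgroup A} (hU : IsOpen (U : Set A)) :
    ∃ i : ℕ × OpenNormalSubgroup X, ∀ s : MonoidAlgebra ℤ X,
      toLevel p i s = r.1 i → b - groupRingAct s a ∈ U :=
  hb _ (hU.mem_nhds U.zero_mem)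

variable [IsProPModule p X A]

variable (X) in
lemma exists_level (V : Set A) (hV : V ∈ 𝓝 (0 : A)) :
    ∃ (U : AddSubgroup A) (i : ℕ × OpenNormalSubgroup X), IsOpen (U : Set A) ∧ (U : Set A) ⊆ V ∧
      (∀ (x : X), ∀ a ∈ U, x • a ∈ U) ∧ ∀ s t : MonoidAlgebra ℤ X,
        toLevel p i s = toLevel p i t → ∀ a : A, groupRingAct s a - groupRingAct t a ∈ U := by
  obtain ⟨U, hU, hUV, hX, ⟨n, hn⟩, N, hN⟩ := IsProPModule.exists_subgroup (p := p) (X := X) V hV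
  refine ⟨U, (n, N), hU, hUV, hX, fun s t hst a => ?_⟩
  have := groupRingAct_mem_of_toLevel_eq_zero p hX hn hN (s := s - t)
    (by rw [map_sub, hst, sub_self]) a
  rwa [map_sub] at this

/-- Below any two levels there is a common one. -/
lemma exists_level_le (i j : ℕ × OpenNormalSubgroup X) :
    ∃ k : ℕ × OpenNormalSubgroup X, (i.1 ≤ k.1 ∧ k.2 ≤ i.2) ∧ (j.1 ≤ k.1 ∧ k.2 ≤ j.2) :=
  ⟨(max i.1 j.1, i.2 ⊓ j.2), ⟨le_max_left _ _, inf_le_left⟩, ⟨le_max_right _ _, inf_le_right⟩⟩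

/-- To check a limit it is enough to have one good approximation for every neighbourhood and
every level. -/
lemma isLimitSMul_of_exists {r : CompletedGroupAlgebra p X} {a b : A}
    (h : ∀ U : AddSubgroup A, IsOpen (U : Set A) → (∀ (x : X), ∀ a ∈ U, x • a ∈ U) →
      ∀ i : ℕ × OpenNormalSubgroup X, ∃ s : MonoidAlgebra ℤ X, toLevel p i s = r.1 i ∧
        b - groupRingAct s a ∈ U) : IsLimitSMul p r a b := by
  intro V hV
  obtain ⟨U, i, hU, hUV, hX, hi⟩ := exists_level p X V hV
  obtain ⟨s, hs, hb⟩ := h U hU hX i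
  refine ⟨i, fun t ht => hUV ?_⟩
  have := U.add_mem hb (hi s t (hs.trans ht.symm) a)
  rwa [sub_add_sub_cancel] at this

lemma IsLimitSMul.unique [T2Space A] {r : CompletedGroupAlgebra p X} {a b c : A}
    (hb : IsLimitSMul p r a b) (hc : IsLimitSMul p r a c) : b = c := by
  by_contra hne
  have hV : {b - c}ᶜ ∈ 𝓝 (0 : A) := isOpen_compl_singleton.mem_nhds
    (by simpa [eq_comm] using sub_ne_zero.mpr hne)
  obtain ⟨U, -, hU, hUV, -, -⟩ := exists_level p X _ hV
  obtain ⟨i, hi⟩ := hb.exists_approx p hU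
  obtain ⟨j, hj⟩ := hc.exists_approx p hU
  obtain ⟨k, hik, hjk⟩ := exists_level_le i j
  obtain ⟨s, hs⟩ := toLevel_surjective p k (r.1 k)
  have h := U.sub_mem (hi s (toLevel_eq_of_le p hik.1 hik.2 hs))
    (hj s (toLevel_eq_of_le p hjk.1 hjk.2 hs))
  rw [sub_sub_sub_cancel_right] at h
  exact hUV h rfl

lemma IsLimitSMul.add_left {r r' : CompletedGroupAlgebra p X} {a b b' : A}
    (hb : IsLimitSMul p r a b) (hb' : IsLimitSMul p r' a b') :
    IsLimitSMul p (r + r') a (b + b') := by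
  refine isLimitSMul_of_exists p fun U hU hX l => ?_
  obtain ⟨i, hi⟩ := hb.exists_approx p hU
  obtain ⟨j, hj⟩ := hb'.exists_approx p hU
  obtain ⟨k, hik, hjk⟩ := exists_level_le i j
  obtain ⟨m, hkm, hlm⟩ := exists_level_le k l
  obtain ⟨s, hs⟩ := toLevel_surjective p m (r.1 m)
  obtain ⟨t, ht⟩ := toLevel_surjective p m (r'.1 m)
  refine ⟨s + t, ?_, ?_⟩
  · rw [map_add, toLevel_eq_of_le p hlm.1 hlm.2 hs, toLevel_eq_of_le p hlm.1 hlm.2 ht]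
    rfl
  · have := U.add_mem
      (hi s (toLevel_eq_of_le p (hik.1.trans hkm.1) (hkm.2.trans hik.2) hs))
      (hj t (toLevel_eq_of_le p (hjk.1.trans hkm.1) (hkm.2.trans hjk.2) ht))
    rw [groupRingAct_add]
    convert this using 1
    abel

lemma IsLimitSMul.add_right {r : CompletedGroupAlgebra p X} {a a' b b' : A}
    (hb : IsLimitSMul p r a b) (hb' : IsLimitSMul p r a' b') :
    IsLimitSMul p r (a + a') (b + b') := by
  refine isLimitSMul_of_exists p fun U hU hX l => ?_
  obtain ⟨i, hi⟩ := hb.exists_approx p hU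
  obtain ⟨j, hj⟩ := hb'.exists_approx p hU
  obtain ⟨k, hik, hjk⟩ := exists_level_le i j
  obtain ⟨m, hkm, hlm⟩ := exists_level_le k l
  obtain ⟨s, hs⟩ := toLevel_surjective p m (r.1 m)
  refine ⟨s, toLevel_eq_of_le p hlm.1 hlm.2 hs, ?_⟩
  have := U.add_mem
    (hi s (toLevel_eq_of_le p (hik.1.trans hkm.1) (hkm.2.trans hik.2) hs))
    (hj s (toLevel_eq_of_le p (hjk.1.trans hkm.1) (hkm.2.trans hjk.2) hs))
  rw [map_add]
  convert this using 1
  abel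

lemma IsLimitSMul.mul {r r' : CompletedGroupAlgebra p X} {a b c : A}
    (hb : IsLimitSMul p r' a b) (hc : IsLimitSMul p r b c) : IsLimitSMul p (r * r') a c := by
  refine isLimitSMul_of_exists p fun U hU hX l => ?_
  obtain ⟨i, hi⟩ := hb.exists_approx p hU
  obtain ⟨j, hj⟩ := hc.exists_approx p hU
  obtain ⟨k, hik, hjk⟩ := exists_level_le i j
  obtain ⟨m, hkm, hlm⟩ := exists_level_le k l
  obtain ⟨s, hs⟩ := toLevel_surjective p m (r.1 m)
  obtain ⟨t, ht⟩ := toLevel_surjective p m (r'.1 m)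
  refine ⟨s * t, ?_, ?_⟩
  · rw [map_mul, toLevel_eq_of_le p hlm.1 hlm.2 hs, toLevel_eq_of_le p hlm.1 hlm.2 ht]
    rfl
  · have := U.add_mem
      (hj s (toLevel_eq_of_le p (hjk.1.trans hkm.1) (hkm.2.trans hjk.2) hs))
      (groupRingAct_mem hX s
        (hi t (toLevel_eq_of_le p (hik.1.trans hkm.1) (hkm.2.trans hik.2) ht)))
    rw [map_sub, sub_add_sub_cancel] at this
    rwa [groupRingAct_mul]

lemma isLimitSMul_toCompleted (s : MonoidAlgebra ℤ X) (a : A) :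
    IsLimitSMul p (toCompleted p s) a (groupRingAct s a) :=
  isLimitSMul_of_exists p fun U _ _ _ => ⟨s, rfl, by rw [sub_self]; exact U.zero_mem⟩

variable [IsTopologicalAddGroup A] [CompactSpace A]

lemma exists_isLimitSMul (r : CompletedGroupAlgebra p X) (a : A) :
    ∃ b : A, IsLimitSMul p r a b := by
  let I := {U : AddSubgroup A // IsOpen (U : Set A)}
  let C : (ℕ × OpenNormalSubgroup X) × I → Set A := fun q =>
    {b | ∃ s : MonoidAlgebra ℤ X, toLevel p q.1 s = r.1 q.1 ∧ b - groupRingAct s a ∈ q.2.1}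
  have hclosed : ∀ q, IsClosed (C q) := by
    intro q
    rw [← isOpen_compl_iff, isOpen_iff_mem_nhds]
    intro b hb
    have h0 : (fun c : A => b - c) ⁻¹' (q.2.1 : Set A) ∈ 𝓝 b := by
      have hc : Continuous fun c : A => b - c := by fun_prop
      refine hc.continuousAt.preimage_mem_nhds ?_
      rw [sub_self]
      exact q.2.2.mem_nhds q.2.1.zero_mem
    filter_upwards [h0] with c hc
    rintro ⟨s, hs, hcs⟩
    refine hb ⟨s, hs, ?_⟩
    have := q.2.1.add_mem hc hcs
    rwa [sub_add_sub_cancel] at this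
  have : Nonempty I := ⟨⟨⊤, isOpen_univ⟩⟩
  have : Nonempty (OpenNormalSubgroup X) := ⟨⟨⊤, inferInstance⟩⟩
  have hdir : Directed (· ⊇ ·) C := by
    rintro ⟨i, U⟩ ⟨j, V⟩
    obtain ⟨k, hik, hjk⟩ := exists_level_le i j
    refine ⟨(k, ⟨U.1 ⊓ V.1, U.2.inter V.2⟩), ?_, ?_⟩
    · rintro b ⟨s, hs, hb⟩
      exact ⟨s, toLevel_eq_of_le p hik.1 hik.2 hs, hb.1⟩
    · rintro b ⟨s, hs, hb⟩
      exact ⟨s, toLevel_eq_of_le p hjk.1 hjk.2 hs, hb.2⟩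
  have hne : ∀ q, (C q).Nonempty := by
    intro q
    obtain ⟨s, hs⟩ := toLevel_surjective p q.1 (r.1 q.1)
    exact ⟨groupRingAct s a, s, hs, by rw [sub_self]; exact q.2.1.zero_mem⟩
  obtain ⟨b, hb⟩ := IsCompact.nonempty_iInter_of_directed_nonempty_isCompact_isClosed C hdir hne
    (fun q => (hclosed q).isCompact) hclosed
  refine ⟨b, isLimitSMul_of_exists p fun U hU _ i => ?_⟩
  obtain ⟨s, hs, h⟩ := Set.mem_iInter.mp hb (i, ⟨U, hU⟩)
  exact ⟨s, hs, h⟩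

variable [T2Space A]

/-- The continuous extension to `ℤ_p[[X]]` of the action of `X` on a pro-`p` `X`-module. -/
instance (priority := 100) completedModule : Module (CompletedGroupAlgebra p X) A where
  smul r a := (exists_isLimitSMul p r a).choose
  one_smul a := (exists_isLimitSMul p 1 a).choose_spec.unique p (by
    have := isLimitSMul_toCompleted p (1 : MonoidAlgebra ℤ X) a
    rw [map_one, map_one] at this
    exact this)
  mul_smul r s a := (exists_isLimitSMul p (r * s) a).choose_spec.unique p
    ((exists_isLimitSMul p s a).choose_spec.mul p (exists_isLimitSMul p r _).choose_spec)
  smul_zero r := (exists_isLimitSMul p r (0 : A)).choose_spec.unique p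
    (isLimitSMul_of_exists p fun U _ _ i => by
      obtain ⟨s, hs⟩ := toLevel_surjective p i (r.1 i)
      exact ⟨s, hs, by rw [map_zero, sub_zero]; exact U.zero_mem⟩)
  smul_add r a b := (exists_isLimitSMul p r (a + b)).choose_spec.unique p
    ((exists_isLimitSMul p r a).choose_spec.add_right p (exists_isLimitSMul p r b).choose_spec)
  add_smul r s a := (exists_isLimitSMul p (r + s) a).choose_spec.unique p
    ((exists_isLimitSMul p r a).choose_spec.add_left p (exists_isLimitSMul p s a).choose_spec)
  zero_smul a := (exists_isLimitSMul p 0 a).choose_spec.unique p (by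
    have := isLimitSMul_toCompleted p (0 : MonoidAlgebra ℤ X) a
    rw [map_zero, map_zero] at this
    exact this)

lemma isLimitSMul_smul (r : CompletedGroupAlgebra p X) (a : A) : IsLimitSMul p r a (r • a) :=
  (exists_isLimitSMul p r a).choose_spec

lemma of_smul (x : X) (a : A) : CompletedGroupAlgebra.of p x • a = x • a := by
  refine (isLimitSMul_smul p _ a).unique p ?_
  have := isLimitSMul_toCompleted p (MonoidAlgebra.single x (1 : ℤ)) a
  rwa [groupRingAct_single, one_smul] at this

end ModuleStructure

/-! ### The derived subgroup as a module -/

section DerivedSubgroup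

open scoped commutatorElement

variable (F : Type*) [Group F] [TopologicalSpace F] [IsTopologicalGroup F]

/-- The derived subgroup of a topological group: the closed subgroup generated by the
commutators. -/
abbrev derivedSubgroup : Subgroup F := (commutator F).topologicalClosure

/-- The derived subgroup `A = F'`, written additively. -/
abbrev DerivedModule : Type _ := Additive (derivedSubgroup F)

/-- The ring `R = ℤ_p[[F / F']]`. -/
abbrev AbelianizedAlgebra (p : ℕ) : Type _ := CompletedGroupAlgebra p (TopologicalAbelianization F)

variable {F}

/-- The commutator `[a, b] = a⁻¹ b⁻¹ a b`, as an element of the derived subgroup written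
additively. -/
def derivedCommutator (a b : F) : DerivedModule F :=
  Additive.ofMul ⟨a⁻¹ * b⁻¹ * a * b, Subgroup.le_topologicalClosure _ (by
    have h : a⁻¹ * b⁻¹ * a * b = ⁅a⁻¹, b⁻¹⁆ := by simp [commutatorElement_def]
    rw [h]
    exact Subgroup.commutator_mem_commutator (Subgroup.mem_top _) (Subgroup.mem_top _))⟩

/-- Conjugation `a ↦ g⁻¹ a g` on the derived subgroup. -/
def derivedConj (g : F) (a : derivedSubgroup F) : derivedSubgroup F :=
  ⟨g⁻¹ * a * g, by
    have := (inferInstance : (derivedSubgroup F).Normal).conj_mem a a.2 g⁻¹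
    rwa [inv_inv] at this⟩

section Metabelian

variable [T2Space F] [IsMetabelianGroup F]

instance derivedSubgroup.commGroup : CommGroup (derivedSubgroup F) where
  mul_comm := ((commutator F).commGroupTopologicalClosure fun a b =>
    Subtype.ext (IsMetabelianGroup.commute (a : F) a.2 (b : F) b.2)).mul_comm
  __ : Group (derivedSubgroup F) := inferInstance

lemma derivedConj_eq {g h : F} (hgh : g⁻¹ * h ∈ derivedSubgroup F) (a : derivedSubgroup F) :
    derivedConj g a = derivedConj h a := by
  have h1 := congrArg Subtype.val (mul_comm (derivedConj g a) ⟨g⁻¹ * h, hgh⟩)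
  apply Subtype.ext
  simp only [derivedConj, Subgroup.coe_mul] at h1 ⊢
  have h2 : h⁻¹ * (a : F) * h = (g⁻¹ * h)⁻¹ * (g⁻¹ * a * g * (g⁻¹ * h)) := by group
  rw [h2, h1]
  group

/-- The action of `F / F'` on `F'` by `a ↦ g⁻¹ a g`; since `F / F'` is commutative, this right
action is also a left action. -/
instance derivedSubgroup.distribMulAction :
    DistribMulAction (TopologicalAbelianization F) (DerivedModule F) where
  smul x a := Quotient.liftOn' x (fun g => Additive.ofMul (derivedConj g a.toMul))
    fun _ _ h => congrArg _ (derivedConj_eq (QuotientGroup.leftRel_apply.mp h) _)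
  one_smul a := by
    apply Additive.toMul.injective
    apply Subtype.ext
    change (1 : F)⁻¹ * (a.toMul : F) * 1 = _
    group
  mul_smul x y a := by
    rw [mul_comm]
    induction x using QuotientGroup.induction_on with | H g => ?_
    induction y using QuotientGroup.induction_on with | H h => ?_
    apply Additive.toMul.injective
    apply Subtype.ext
    change (h * g)⁻¹ * (a.toMul : F) * (h * g) = g⁻¹ * (h⁻¹ * (a.toMul : F) * h) * g
    group
  smul_zero x := by
    induction x using QuotientGroup.induction_on with | H g => ?_
    apply Additive.toMul.injective
    apply Subtype.ext
    change g⁻¹ * (1 : F) * g = 1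
    group
  smul_add x a b := by
    induction x using QuotientGroup.induction_on with | H g => ?_
    apply Additive.toMul.injective
    apply Subtype.ext
    change g⁻¹ * ((a.toMul : F) * (b.toMul : F)) * g =
      (g⁻¹ * (a.toMul : F) * g) * (g⁻¹ * (b.toMul : F) * g)
    group

lemma derivedSubgroup.mk_smul (g : F) (a : derivedSubgroup F) :
    (QuotientGroup.mk g : TopologicalAbelianization F) • Additive.ofMul a =
      Additive.ofMul (derivedConj g a) := rfl

end Metabelian

variable (p : ℕ) [CompactSpace F] [T2Space F] [TotallyDisconnectedSpace F] [IsProP p F]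
  [IsMetabelianGroup F]

instance derivedSubgroup.compactSpace : CompactSpace (DerivedModule F) :=
  isCompact_iff_compactSpace.mp (Subgroup.isClosed_topologicalClosure (commutator F)).isCompact

instance derivedSubgroup.isProPModule :
    IsProPModule p (TopologicalAbelianization F) (DerivedModule F) where
  exists_subgroup V hV := by
    have hV' : V ∈ 𝓝 (1 : derivedSubgroup F) := hV
    obtain ⟨W, hW, hWV⟩ := mem_nhds_subtype _ _ _ |>.mp hV'
    obtain ⟨O, hOW, hO, hO1⟩ := mem_nhds_iff.mp hW
    obtain ⟨N, hN⟩ := ProfiniteGrp.exist_openNormalSubgroup_sub_open_nhds_of_one hO hO1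
    have hopen : IsOpen ((QuotientGroup.mk : F → TopologicalAbelianization F) '' N) :=
      QuotientGroup.isOpenMap_coe _ N.isOpen'
    refine ⟨(N.toSubgroup.subgroupOf (derivedSubgroup F)).toAddSubgroup, ?_, ?_, ?_, ?_, ?_⟩
    · exact N.isOpen'.preimage continuous_subtype_val
    · exact fun a ha => hWV (hOW (hN ha))
    · intro x a ha
      induction x using QuotientGroup.induction_on with | H g => ?_
      have := N.isNormal'.conj_mem _ ha g⁻¹
      rw [inv_inv] at this
      exact this
    · obtain ⟨k, hk⟩ := IsProP.index_eq_pow (p := p) N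
      refine ⟨k, fun a => ?_⟩
      have := Subgroup.pow_index_mem N.toSubgroup (a.toMul : F)
      rw [hk] at this
      exact this
    · refine ⟨⟨⟨N.toSubgroup.map (QuotientGroup.mk' _), hopen⟩,
        N.isNormal'.map _ (QuotientGroup.mk'_surjective _)⟩, ?_⟩
      rintro _ ⟨g, hg, rfl⟩ a
      have h1 := N.isNormal'.conj_mem _ hg (a.toMul : F)
      have h2 := N.toSubgroup.mul_mem (N.toSubgroup.inv_mem hg) h1
      have h3 : g⁻¹ * (a.toMul * g * (a.toMul : F)⁻¹) = g⁻¹ * a.toMul * g / (a.toMul : F) := by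
        rw [div_eq_mul_inv]
        group
      rw [h3] at h2
      exact h2

/-- The element `ξ = x - 1` of `R`, where `x = gF'`. -/
def xiElement (g : F) : AbelianizedAlgebra F p :=
  CompletedGroupAlgebra.of p (QuotientGroup.mk g : TopologicalAbelianization F) - 1

/-- The submodule `Aξ` of all multiples `aξ`, `a ∈ A`, where `ξ = gF' - 1`. -/
def xiMultiples (g : F) : Submodule (AbelianizedAlgebra F p) (DerivedModule F) :=
  LinearMap.range (LinearMap.lsmul (AbelianizedAlgebra F p) (DerivedModule F) (xiElement p g))

/-- The elements `u_{id} = [g_i, g_d]` of `A`, for the indices `i` other than the last one. -/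
def lastCommutators {d : ℕ} (hd : 2 ≤ d) (g : Fin d → F) (i : Fin (d - 1)) : DerivedModule F :=
  derivedCommutator (g (i.castLE (Nat.sub_le d 1))) (g ⟨d - 1, by omega⟩)

end DerivedSubgroup

end

universe v w

/-!
By freeness there are Fox derivatives `∂ₖ : F → R`, the crossed homomorphisms over `F → Rˣ` with
`∂ₖ gᵢ = δᵢₖ`; they are `R`-linear on `F'`. A crossed homomorphism `K` is determined by its values
on the generators: `K x = ∑ₖ ∂ₖ x · K gₖ`. For `K x = x - 1` this is Fox's identity
`∑ₖ ∂ₖ x · ξₖ = ξ(x)`, whose right side vanishes on `F'`. For the Kaloujnine-Krasner cocycles of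
the finite quotients of `F` over their abelianized images it shows that `∂ₖ a = 0` for all `k`
forces `a = 0` in `F'`: this is the Magnus embedding `F' → R^d`.

Since `∂ₖ[gᵢ, g_d] = ξ_d δᵢₖ - ξᵢ δ_dₖ`, comparing derivatives gives `a ξ_d = ∑ᵢ [gᵢ, g_d] ∂ᵢ a`.
Injectivity of `ξ_d` and independence of the `[gᵢ, g_d]` reduce, after applying the `∂ₖ`, to `ξ_d`
being a non-zero-divisor of `R`. Indeed, if `r x_d = r`, then for a small open `M ≤ N` the
coefficients of `r` in `(ℤ/pⁿ)[X/M]` are constant on the cosets of a cyclic subgroup of `N/M` of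
order divisible by `pⁿ`, so `r` maps to `0` in `(ℤ/pⁿ)[X/N]`.
-/

noncomputable section

lemma IsMetabelianGroup.of_ker_comm {G Q : Type*} [Group G] [CommGroup Q] (f : G →* Q)
    (h : ∀ a ∈ f.ker, ∀ b ∈ f.ker, a * b = b * a) : IsMetabelianGroup G :=
  ⟨fun a ha b hb => h a (Abelianization.commutator_subset_ker f ha) b
    (Abelianization.commutator_subset_ker f hb)⟩

lemma IsMetabelianGroup.of_injective {G H : Type*} [Group G] [Group H] [IsMetabelianGroup G]
    (f : H →* G) (hf : Function.Injective f) : IsMetabelianGroup H where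
  commute a ha b hb := hf <| by
    have hmap : ∀ c ∈ commutator H, f c ∈ commutator G := fun c hc =>
      Subgroup.commutator_mono le_top le_top
        (Subgroup.map_commutator ⊤ ⊤ f ▸ Subgroup.mem_map_of_mem f hc)
    rw [map_mul, map_mul]
    exact IsMetabelianGroup.commute _ (hmap a ha) _ (hmap b hb)

section ProP

variable {p : ℕ} {G : Type*} [Group G] [TopologicalSpace G] [IsTopologicalGroup G]
  [CompactSpace G] [T2Space G] [TotallyDisconnectedSpace G]

lemma IsProP.of_isPGroup [Fact p.Prime] [Finite G] (h : IsPGroup p G) : IsProP p G :=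
  ⟨fun N => h.index N.toSubgroup⟩

lemma IsProP.isPGroup_of_surjective [IsProP p G] {Q : Type*} [Group Q] {f : G →* Q}
    (hf : IsLocallyConstant f) (hsurj : Function.Surjective f) : IsPGroup p Q := by
  obtain ⟨k, hk⟩ := IsProP.index_eq_pow (p := p) ⟨⟨f.ker, hf.isOpen_fiber 1⟩, f.normal_ker⟩
  refine isPGroup_iff_pow_pow_eq_one.mpr fun q => ?_
  obtain ⟨x, rfl⟩ := hsurj q
  exact ⟨k, by rw [← map_pow, ← hk]; exact f.ker.pow_index_mem x⟩

lemma IsProP.subgroup [Fact p.Prime] [IsProP p G] (K : Subgroup G) [CompactSpace K] :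
    IsProP p K where
  index_eq_pow N := by
    obtain ⟨W, hW, hWN⟩ := isOpen_induced_iff.mp N.isOpen'
    obtain ⟨M, hM⟩ := ProfiniteGrp.exist_openNormalSubgroup_sub_open_nhds_of_one hW
      (show (1 : K) ∈ Subtype.val ⁻¹' W from hWN ▸ N.one_mem)
    have hMN : M.toSubgroup.subgroupOf K ≤ N.toSubgroup := fun x hx =>
      (Set.ext_iff.mp hWN x).mp (hM hx)
    obtain ⟨k, hk⟩ := IsProP.index_eq_pow (p := p) M
    obtain ⟨l, -, hl⟩ := (Nat.dvd_prime_pow Fact.out).mp <| hk ▸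
      (Subgroup.index_dvd_of_le hMN).trans (M.toSubgroup.relIndex_dvd_index_of_normal K)
    exact ⟨l, hl⟩

end ProP

lemma isLocallyConstant_quotientGroupMk {G : Type*} [Group G] [TopologicalSpace G]
    [SeparatelyContinuousMul G] {N : Subgroup G} (hN : IsOpen (N : Set G)) :
    IsLocallyConstant (QuotientGroup.mk : G → G ⧸ N) := by
  have := QuotientGroup.discreteTopology hN
  exact (IsLocallyConstant.iff_continuous _).mpr QuotientGroup.continuous_mk

lemma eq_one_of_forall_mem_openNormalSubgroup {G : Type*} [Group G] [TopologicalSpace G]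
    [IsTopologicalGroup G] [CompactSpace G] [TotallyDisconnectedSpace G] {x : G}
    (h : ∀ N : OpenNormalSubgroup G, x ∈ N) : x = 1 := by
  by_contra hx
  obtain ⟨N, hN⟩ := ProfiniteGrp.exist_openNormalSubgroup_sub_open_nhds_of_one
    (isOpen_compl_singleton (x := x)) (Ne.symm hx)
  exact hN (h N) rfl

lemma monoidHom_ext_of_dense_closure {G Q : Type*} [Group G] [TopologicalSpace G] [Group Q]
    {S : Set G} (hS : Dense (Subgroup.closure S : Set G)) {φ ψ : G →* Q}
    (hφ : IsLocallyConstant φ) (hψ : IsLocallyConstant ψ) (h : Set.EqOn φ ψ S) : φ = ψ := by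
  let : TopologicalSpace Q := ⊥
  have : DiscreteTopology Q := ⟨rfl⟩
  exact DFunLike.coe_injective <|
    hφ.continuous.ext_on hS hψ.continuous (MonoidHom.eqOn_closure h)

namespace IsFreeMetabelianProP

variable {p : ℕ} {ι : Type*} [Finite ι] {F : Type u} [Group F] [TopologicalSpace F]
  [IsTopologicalGroup F] [CompactSpace F] [T2Space F] [TotallyDisconnectedSpace F] [IsProP p F]
  [IsMetabelianGroup F] {g : ι → F} [Fact p.Prime]

lemma dense_closure_range (hg : IsFreeMetabelianProP p g) :
    Dense (Subgroup.closure (Set.range g) : Set F) := by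
  let K := (Subgroup.closure (Set.range g)).topologicalClosure
  have : CompactSpace K :=
    isCompact_iff_compactSpace.mp (Subgroup.isClosed_topologicalClosure _).isCompact
  have := IsProP.subgroup (p := p) K
  have := IsMetabelianGroup.of_injective K.subtype K.subtype_injective
  have hmem (i : ι) : g i ∈ K :=
    Subgroup.le_topologicalClosure _ (Subgroup.subset_closure (Set.mem_range_self i))
  obtain ⟨φ, hφ, -⟩ := hg.existsUnique_lift K fun i => ⟨g i, hmem i⟩
  have hid : (⟨K.subtype, continuous_subtype_val⟩ : K →ₜ* F).comp φ = ContinuousMonoidHom.id F :=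
    (hg.existsUnique_lift F g).unique (fun i => congrArg Subtype.val (hφ i)) fun _ => rfl
  intro x
  have hx : (φ x : F) = x := DFunLike.congr_fun hid x
  exact hx ▸ (φ x).2

lemma exists_lift (hg : IsFreeMetabelianProP p g) {G : Type*} [Group G] [Finite G]
    [IsMetabelianGroup G] (hG : IsPGroup p G) (c : ι → G) :
    ∃ φ : F →* G, IsLocallyConstant φ ∧ ∀ i, φ (g i) = c i := by
  have := Countable.toSmall G
  let e : Shrink.{u} G ≃* G := Shrink.mulEquiv
  let : TopologicalSpace (Shrink.{u} G) := ⊥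
  have : DiscreteTopology (Shrink.{u} G) := ⟨rfl⟩
  have := IsMetabelianGroup.of_injective e.toMonoidHom e.injective
  have := IsProP.of_isPGroup (hG.of_equiv e.symm)
  obtain ⟨φ, hφ, -⟩ := hg.existsUnique_lift (Shrink.{u} G) fun i => e.symm (c i)
  refine ⟨e.toMonoidHom.comp φ.toMonoidHom,
    ((IsLocallyConstant.iff_continuous φ).mpr φ.continuous).comp e, fun i => ?_⟩
  exact e.eq_symm_apply.mp (hφ i)

end IsFreeMetabelianProP

/-! ### Crossed homomorphisms -/

/-- Crossed homomorphisms `D (x y) = D x · y + D y` into a right module on which `G` acts through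
`χ`; the action is written on the left, which is harmless as the target of `χ` is commutative. -/
def IsCrossedHom {G Λ M : Type*} [Group G] [CommMonoid Λ] [Add M] [SMul Λ M] (χ : G →* Λ)
    (D : G → M) : Prop :=
  ∀ x y, D (x * y) = χ y • D x + D y

namespace IsCrossedHom

variable {G Λ M : Type*} [Group G] [CommRing Λ] [AddCommGroup M] [Module Λ M] {χ : G →* Λ}
  {D : G → M}

lemma map_one (hD : IsCrossedHom χ D) : D 1 = 0 := by
  simpa only [mul_one, _root_.map_one, one_smul, right_eq_add] using hD 1 1

lemma map_inv (hD : IsCrossedHom χ D) (x : G) : D x⁻¹ = -(χ x⁻¹ • D x) := by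
  rw [eq_neg_iff_add_eq_zero, add_comm, ← hD, mul_inv_cancel, hD.map_one]

lemma map_conj (hD : IsCrossedHom χ D) (x : G) {a : G} (ha : χ a = 1) :
    D (x⁻¹ * a * x) = χ x • D a := by
  have h := hD x (x⁻¹ * a * x)
  have hχ : χ (x⁻¹ * a * x) = 1 := by
    rw [map_mul, map_mul, ha, mul_one, ← map_mul, inv_mul_cancel, _root_.map_one]
  rw [hχ, one_smul, show x * (x⁻¹ * a * x) = a * x by group, hD, add_comm] at h
  exact (add_left_cancel h).symm

lemma map_commutator (hD : IsCrossedHom χ D) (a b : G) :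
    D (a⁻¹ * b⁻¹ * a * b) = (χ b - 1) • D a - (χ a - 1) • D b := by
  have h := hD (b * a) (a⁻¹ * b⁻¹ * a * b)
  have hχ : χ (a⁻¹ * b⁻¹ * a * b) = 1 := by
    have ha : χ a⁻¹ * χ a = 1 := by rw [← map_mul, inv_mul_cancel, _root_.map_one]
    have hb : χ b⁻¹ * χ b = 1 := by rw [← map_mul, inv_mul_cancel, _root_.map_one]
    simp only [map_mul]
    linear_combination χ b⁻¹ * χ b * ha + hb
  rw [hχ, one_smul, show b * a * (a⁻¹ * b⁻¹ * a * b) = a * b by group, hD, hD b] at h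
  rw [← sub_eq_iff_eq_add'.mpr h, sub_smul, sub_smul, one_smul, one_smul]
  abel

lemma sub_one (χ : G →* Λ) : IsCrossedHom χ fun x => χ x - 1 := fun x y => by
  simp only [map_mul, smul_eq_mul]
  ring

lemma sub {D' : G → M} (hD : IsCrossedHom χ D) (hD' : IsCrossedHom χ D') :
    IsCrossedHom χ fun x => D x - D' x := fun x y => by
  simp only [hD x y, hD' x y, smul_sub]
  abel

lemma map {Λ' : Type*} [CommRing Λ'] {D : G → Λ} (hD : IsCrossedHom χ D) (φ : Λ →+* Λ') :
    IsCrossedHom (φ.toMonoidHom.comp χ) fun x => φ (D x) := fun x y => by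
  beta_reduce
  rw [hD, map_add, smul_eq_mul, map_mul]
  rfl

lemma sum_smul {ι : Type*} [Fintype ι] {D : ι → G → Λ} (hD : ∀ k, IsCrossedHom χ (D k))
    (m : ι → M) : IsCrossedHom χ fun x => ∑ k, D k x • m k := fun x y => by
  simp only [hD _ x y, add_smul, Finset.sum_add_distrib, Finset.smul_sum, smul_assoc]

variable {S : Set G} [TopologicalSpace G]

lemma eq_zero_of_dense_closure (hD : IsCrossedHom χ D) (hlc : IsLocallyConstant D)
    (hS : Dense (Subgroup.closure S : Set G)) (h : ∀ s ∈ S, D s = 0) (x : G) : D x = 0 := by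
  have hsub : (Subgroup.closure S : Set G) ⊆ {x | D x = 0} := fun x hx => by
    induction hx using Subgroup.closure_induction with
    | mem s hs => exact h s hs
    | one => exact hD.map_one
    | mul x y _ _ hx hy => rw [Set.mem_ofPred_eq, hD, hx, hy, smul_zero, zero_add]
    | inv x _ hx => rw [Set.mem_ofPred_eq, hD.map_inv, hx, smul_zero, neg_zero]
  exact (hlc.isClosed_fiber 0).closure_subset_iff.mpr hsub (hS x)

lemma eq_of_dense_closure {D' : G → M} (hD : IsCrossedHom χ D) (hD' : IsCrossedHom χ D')
    (hlc : IsLocallyConstant D) (hlc' : IsLocallyConstant D')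
    (hS : Dense (Subgroup.closure S : Set G)) (h : Set.EqOn D D' S) : D = D' :=
  funext fun x => sub_eq_zero.mp <| (hD.sub hD').eq_zero_of_dense_closure (hlc.sub hlc') hS
    (fun _ hs => sub_eq_zero.mpr (h hs)) x

lemma eq_sum_smul_of_dense_closure {ι : Type*} [Fintype ι] [DecidableEq ι] {g : ι → G}
    (hg : Dense (Subgroup.closure (Set.range g) : Set G)) {K : G → M} (hK : IsCrossedHom χ K)
    (hKlc : IsLocallyConstant K) {D : ι → G → Λ} (hD : ∀ k, IsCrossedHom χ (D k))
    (hDlc : ∀ k, IsLocallyConstant (D k))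
    (hDg : ∀ k i, D k (g i) = (Pi.single k 1 : ι → Λ) i) (x : G) :
    K x = ∑ k, D k x • K (g k) := by
  have hsumlc : IsLocallyConstant fun x => ∑ k, D k x • K (g k) := by
    refine (IsLocallyConstant.iff_eventually_eq _).mpr fun x => ?_
    filter_upwards [Filter.eventually_all.mpr fun k => (hDlc k).eventually_eq x] with y hy
    simp only [hy]
  refine congrFun (hK.eq_of_dense_closure (sum_smul hD _) hKlc hsumlc hg ?_) x
  rintro _ ⟨i, rfl⟩
  simp only [hDg, Pi.single_apply, ite_smul, one_smul, zero_smul, Finset.sum_ite_eq,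
    Finset.mem_univ, if_true]

end IsCrossedHom

section Existence

variable {p : ℕ} [Fact p.Prime] {N H : Type*} [CommGroup N] [CommGroup H] {φ : H →* MulAut N}

lemma isMetabelianGroup_semidirectProduct : IsMetabelianGroup (N ⋊[φ] H) :=
  IsMetabelianGroup.of_ker_comm SemidirectProduct.rightHom <| by
    rw [← SemidirectProduct.range_inl_eq_ker_rightHom]
    rintro _ ⟨a, rfl⟩ _ ⟨b, rfl⟩
    rw [← map_mul, mul_comm, map_mul]

lemma isPGroup_semidirectProduct [Finite N] [Finite H] (hN : IsPGroup p N) (hH : IsPGroup p H) :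
    IsPGroup p (N ⋊[φ] H) := by
  obtain ⟨m, hm⟩ := IsPGroup.iff_card.mp hN
  obtain ⟨n, hn⟩ := IsPGroup.iff_card.mp hH
  exact IsPGroup.of_card (n := m + n) (by rw [SemidirectProduct.card, hm, hn, pow_add])

end Existence

namespace IsFreeMetabelianProP

variable {p : ℕ} [Fact p.Prime] {ι : Type*} [Finite ι] {F : Type u} [Group F] [TopologicalSpace F]
  [IsTopologicalGroup F] [CompactSpace F] [T2Space F] [TotallyDisconnectedSpace F] [IsProP p F]
  [IsMetabelianGroup F] {g : ι → F}

lemma exists_isCrossedHom (hg : IsFreeMetabelianProP p g) {Λ M : Type*} [CommRing Λ]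
    [AddCommGroup M] [Module Λ M] [Finite M] (hM : IsPGroup p (Multiplicative M)) {χ : F →* Λ}
    (hχ : IsLocallyConstant χ) (c : ι → M) :
    ∃ D : F → M, IsCrossedHom χ D ∧ IsLocallyConstant D ∧ ∀ i, D (g i) = c i := by
  let π : F →* χ.toHomUnits.range := χ.toHomUnits.rangeRestrict
  have hπ : IsLocallyConstant π :=
    IsLocallyConstant.desc π (fun q => (q : Λˣ).val) hχ
      (Units.val_injective.comp Subtype.val_injective)
  have hπsurj : Function.Surjective π := χ.toHomUnits.rangeRestrict_surjective
  have : Finite χ.toHomUnits.range := Set.finite_univ_iff.mp (hπsurj.range_eq ▸ hπ.range_finite)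
  let conj : χ.toHomUnits.range →* MulAut (Multiplicative M) :=
    (MulAutMultiplicative M).symm.toMonoidHom.comp (DistribMulAction.toAddAut _ M)
  let E := Multiplicative M ⋊[conj] χ.toHomUnits.range
  have : Finite E := Finite.of_equiv _ SemidirectProduct.equivProd.symm
  have : IsMetabelianGroup E := isMetabelianGroup_semidirectProduct
  -- `M ⋊ π(F)` classifies left crossed homomorphisms; inverting `π` passes to the right ones.
  obtain ⟨φ, hφ, hφg⟩ := hg.exists_lift (isPGroup_semidirectProduct (φ := conj) hM
    (IsProP.isPGroup_of_surjective hπ hπsurj))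
    fun i => ⟨.ofAdd ((π (g i))⁻¹ • c i), (π (g i))⁻¹⟩
  have hright (x : F) : (φ x).right = (π x)⁻¹ := DFunLike.congr_fun
    (f := SemidirectProduct.rightHom.comp φ) (g := invMonoidHom.comp π)
    (monoidHom_ext_of_dense_closure hg.dense_closure_range
      (hφ.comp SemidirectProduct.right) (hπ.comp Inv.inv)
      fun _ ⟨i, hi⟩ => hi ▸ congrArg SemidirectProduct.right (hφg i)) x
  have hmul (x y : F) : (φ (x * y)).left.toAdd = (φ x).left.toAdd + (π x)⁻¹ • (φ y).left.toAdd :=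
    by rw [← hright, map_mul]; rfl
  refine ⟨fun x => π x • (φ x).left.toAdd, fun x y => ?_,
    hπ.comp₂ hφ fun q e => q • e.left.toAdd, fun i => ?_⟩
  · beta_reduce
    rw [hmul, map_mul, mul_comm (π x), smul_add, smul_smul _ (π x)⁻¹, mul_inv_cancel_right,
      mul_smul]
    rfl
  · beta_reduce
    rw [hφg]
    exact smul_inv_smul (π (g i)) (c i)

end IsFreeMetabelianProP

section KaloujnineKrasner

variable {G : Type v} {Q : Type w} [Group G] [CommGroup Q] {f : G →* Q} {s : Q → G}

/-- The Kaloujnine-Krasner cocycle `x ↦ (q ↦ s (f x · q)⁻¹ x s q)` of an extension with section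
`s`, which embeds the extension into the wreath product of its kernel with its quotient. -/
def kaloujnineKrasner (hs : Function.RightInverse s f) (x : G) (q : Q) : Additive f.ker :=
  Additive.ofMul ⟨(s (f x * q))⁻¹ * x * s q, by
    rw [MonoidHom.mem_ker, map_mul, map_mul, map_inv, hs, hs]
    group⟩

variable (hs : Function.RightInverse s f)

lemma kaloujnineKrasner_mul (x y : G) (q : Q) :
    kaloujnineKrasner hs (x * y) q =
      kaloujnineKrasner hs x (f y * q) + kaloujnineKrasner hs y q := by
  refine Additive.toMul.injective (Subtype.ext ?_)
  change (s (f (x * y) * q))⁻¹ * (x * y) * s q =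
    (s (f x * (f y * q)))⁻¹ * x * s (f y * q) * ((s (f y * q))⁻¹ * y * s q)
  rw [map_mul, mul_assoc (f x)]
  group

lemma eq_one_of_kaloujnineKrasner_eq_zero {a : G} (ha : a ∈ f.ker) {q : Q}
    (h : kaloujnineKrasner hs a q = 0) : a = 1 := by
  have h1 : (s (f a * q))⁻¹ * a * s q = 1 := congrArg (fun b => (b.toMul : G)) h
  rw [MonoidHom.mem_ker.mp ha, one_mul] at h1
  exact conj_eq_one_iff (a := (s q)⁻¹) |>.mp (by rwa [inv_inv])

lemma exists_isCrossedHom_eq_one_of_mem_ker (hf : Function.Surjective f)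
    (hcomm : ∀ a ∈ f.ker, ∀ b ∈ f.ker, a * b = b * a) {m : ℕ} (hm : ∀ a ∈ f.ker, a ^ m = 1) :
    ∃ (M : Type (max v w)) (_ : AddCommGroup M) (_ : Module (MonoidAlgebra (ZMod m) Q) M)
      (K : G → M), IsCrossedHom ((MonoidAlgebra.of (ZMod m) Q).comp f) K ∧
        ∀ a ∈ f.ker, K a = 0 → a = 1 := by
  obtain ⟨s, hs⟩ := hf.hasRightInverse
  let : CommGroup f.ker :=
    { mul_comm := fun a b => Subtype.ext (hcomm a a.2 b b.2) }
  let : Module (ZMod m) (Additive f.ker) := AddCommGroup.zmodModule fun a =>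
    Additive.toMul.injective (Subtype.ext (hm _ a.toMul.2))
  let ρ : Representation (ZMod m) Q (Q → Additive f.ker) :=
    { toFun := fun q => LinearMap.funLeft _ _ (q * ·)
      map_one' := by ext; simp
      map_mul' := fun q r => by ext h t; simp [mul_comm q r, mul_assoc] }
  refine ⟨ρ.asModule, inferInstance, inferInstance,
    fun x => ρ.asModuleEquiv.symm (kaloujnineKrasner hs x), fun x y => ?_, fun a ha h => ?_⟩
  · have hxy : kaloujnineKrasner hs (x * y) =
        ρ (f y) (kaloujnineKrasner hs x) + kaloujnineKrasner hs y :=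
      funext (kaloujnineKrasner_mul hs x y)
    beta_reduce
    rw [hxy, map_add, Representation.asModuleEquiv_symm_map_rho]
    rfl
  · exact eq_one_of_kaloujnineKrasner_eq_zero hs ha
      (congrFun ((map_eq_zero_iff _ ρ.asModuleEquiv.symm.injective).mp h) 1)

end KaloujnineKrasner

/-! ### Non-zero-divisors of `ℤ_p[[X]]` -/

section NonZeroDivisors

lemma sum_eq_zero_of_mul_right_invariant {P V : Type*} [Group P] [Fintype P] [AddCommMonoid V]
    (H : Subgroup P) (hV : ∀ v : V, Nat.card H • v = 0) {φ : P → V}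
    (hφ : ∀ q, ∀ h ∈ H, φ (q * h) = φ q) : ∑ q, φ q = 0 := by
  classical
  have := Fintype.ofFinite (P ⧸ H)
  let φ' : P ⧸ H → V := Quotient.lift φ fun a b hab => by
    rw [← hφ a _ (QuotientGroup.leftRel_apply.mp hab), mul_inv_cancel_left]
  have hcard (c : P ⧸ H) :
      (Finset.univ.filter fun q : P => (QuotientGroup.mk q : P ⧸ H) = c).card = Nat.card H := by
    have h := QuotientGroup.card_preimage_mk H {c}
    rw [Nat.card_unique (α := ({c} : Set (P ⧸ H))), mul_one] at h
    rw [← h, ← Fintype.card_subtype, ← Nat.card_eq_fintype_card]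
    rfl
  calc ∑ q, φ q = ∑ q, φ' (QuotientGroup.mk q) := rfl
    _ = ∑ c, ∑ q with (QuotientGroup.mk q : P ⧸ H) = c, φ' c :=
        (Finset.sum_fiberwise' _ _ _).symm
    _ = 0 := Finset.sum_eq_zero fun c _ => by rw [Finset.sum_const, hcard, hV]

lemma mapDomain_eq_zero_of_mul_single_eq {S P P' : Type*} [Semiring S] [Group P] [Finite P]
    [Monoid P'] {f : P →* P'} {H : Subgroup P} (hf : ∀ h ∈ H, f h = 1)
    (hH : (Nat.card H : S) = 0) {t : MonoidAlgebra S P}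
    (ht : ∀ h ∈ H, t * MonoidAlgebra.single h 1 = t) : MonoidAlgebra.mapDomain f t = 0 := by
  have := Fintype.ofFinite P
  have hcoeff : ∀ q, ∀ h ∈ H, t.coeff (q * h) = t.coeff q := fun q h hh => by
    conv_lhs => rw [← ht h hh, MonoidAlgebra.coeff_mul_single_apply, mul_one, mul_inv_cancel_right]
  have hsum : MonoidAlgebra.mapDomain f t =
      ∑ q, MonoidAlgebra.single (f q) (t.coeff q) := by
    conv_lhs => rw [← t.sum_coeff_single, MonoidAlgebra.mapDomain_sum,
      Finsupp.sum_fintype _ _ fun q => by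
        rw [MonoidAlgebra.single_zero, MonoidAlgebra.mapDomain_zero]]
    simp only [MonoidAlgebra.mapDomain_single]
  rw [hsum]
  refine sum_eq_zero_of_mul_right_invariant H (fun v => ?_) fun q h hh => ?_
  · rw [← Nat.cast_smul_eq_nsmul S, hH, zero_smul]
  · rw [map_mul, hf h hh, mul_one, hcoeff q h hh]

lemma dvd_orderOf_pow_of_mul_dvd_orderOf {G : Type*} [Group G] {x : G} {a b : ℕ} (ha : 0 < a)
    (h : a * b ∣ orderOf x) : b ∣ orderOf (x ^ a) :=
  Nat.dvd_of_mul_dvd_mul_left ha <| h.trans <| orderOf_dvd_of_pow_eq_one <| by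
    rw [pow_mul, pow_orderOf_eq_one]

end NonZeroDivisors

namespace CompletedGroupAlgebra

variable (p : ℕ) {X : Type*} [CommGroup X] [TopologicalSpace X]

/-- The projection `ℤ_p[[X]] → (ℤ/pⁿ)[X/N]`. -/
def level (i : ℕ × OpenNormalSubgroup X) : CompletedGroupAlgebra p X →+* LevelAlgebra p X i :=
  (Pi.evalRingHom _ i).comp (completedGroupAlgebraSubring p X).subtype

variable {p}

lemma ext_level {r s : CompletedGroupAlgebra p X} (h : ∀ i, level p i r = level p i s) : r = s :=
  Subtype.ext (funext h)

lemma levelMap_level {i j : ℕ × OpenNormalSubgroup X} (hn : i.1 ≤ j.1) (hN : j.2 ≤ i.2)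
    (r : CompletedGroupAlgebra p X) : levelMap p hn hN (level p j r) = level p i r :=
  r.2 i j hn hN

lemma level_of (i : ℕ × OpenNormalSubgroup X) (x : X) :
    level p i (of p x) = MonoidAlgebra.single (QuotientGroup.mk x) 1 := by
  change toLevel p i (MonoidAlgebra.single x 1) = _
  simp [toLevel]

lemma level_eq_zero_of_mul_of_eq [CompactSpace X] [SeparatelyContinuousMul X]
    {n : ℕ} {M N : OpenNormalSubgroup X} (hMN : M ≤ N) {x : X} (hx : x ∈ N)
    (hord : p ^ n ∣ orderOf (QuotientGroup.mk x : X ⧸ M.toSubgroup))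
    {r : CompletedGroupAlgebra p X} (hr : ∀ k : ℕ, r * of p (x ^ k) = r) :
    level p (n, N) r = 0 := by
  have : Finite (X ⧸ M.toSubgroup) := M.toSubgroup.quotient_finite_of_isOpen M.isOpen
  let H := Subgroup.zpowers (QuotientGroup.mk x : X ⧸ M.toSubgroup)
  have hmap : MonoidAlgebra.mapDomain (QuotientGroup.map M.toSubgroup N.toSubgroup
      (MonoidHom.id X) hMN) (level p (n, M) r) = 0 := by
    refine mapDomain_eq_zero_of_mul_single_eq (H := H) ?_ ?_ ?_
    · exact fun h hh => (Subgroup.zpowers_le (H := (QuotientGroup.map M.toSubgroup N.toSubgroup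
        (MonoidHom.id X) hMN).ker)).mpr ((QuotientGroup.eq_one_iff x).mpr hx) hh
    · rw [Nat.card_zpowers, ZMod.natCast_eq_zero_iff]
      exact hord
    · intro h hh
      obtain ⟨k, rfl⟩ := mem_powers_iff_mem_zpowers.mpr hh
      have hk := congrArg (level p (n, M)) (hr k)
      rwa [map_mul, level_of] at hk
  rw [← levelMap_level (i := (n, N)) (j := (n, M)) le_rfl hMN]
  rw [levelMap, RingHom.comp_apply]
  exact (congrArg (MonoidAlgebra.mapRingHom _ _) hmap).trans (map_zero _)

lemma of_sub_one_mem_nonZeroDivisors [CompactSpace X] [SeparatelyContinuousMul X]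
    (hp : 0 < p) {x : X}
    (hx : ∀ N : OpenNormalSubgroup X, ∃ e, x ^ p ^ e ∈ N)
    (hord : ∀ k, ∃ N : OpenNormalSubgroup X,
      p ^ k ∣ orderOf (QuotientGroup.mk x : X ⧸ N.toSubgroup)) :
    of p x - 1 ∈ nonZeroDivisors (CompletedGroupAlgebra p X) := by
  refine mem_nonZeroDivisors_iff_right.mpr fun r hr => ext_level fun ⟨n, N⟩ => ?_
  rw [mul_sub, mul_one, sub_eq_zero] at hr
  obtain ⟨e, he⟩ := hx N
  obtain ⟨M, hM⟩ := hord (e + n)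
  have hpow (k : ℕ) : r * of p (x ^ k) = r := by
    induction k with
    | zero => rw [pow_zero, map_one, mul_one]
    | succ k ih => rw [pow_succ', map_mul, ← mul_assoc, hr, ih]
  refine level_eq_zero_of_mul_of_eq (M := M ⊓ N) inf_le_right he ?_ fun k => ?_
  · refine dvd_orderOf_pow_of_mul_dvd_orderOf
      (x := (QuotientGroup.mk x : X ⧸ (M ⊓ N).toSubgroup)) (pow_pos hp e) ?_
    rw [← pow_add]
    exact hM.trans (orderOf_map_dvd (QuotientGroup.map (M ⊓ N).toSubgroup M.toSubgroup
      (MonoidHom.id X) inf_le_left) _)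
  · rw [← pow_mul, hpow]

end CompletedGroupAlgebra

/-! ### Fox derivatives -/

namespace CompletedGroupAlgebra

variable {p : ℕ} {X A : Type*} [CommGroup X] [TopologicalSpace X] [AddCommGroup A]
  [DistribMulAction X A]

lemma map_groupRingAct {f : A →+ CompletedGroupAlgebra p X}
    (hf : ∀ (x : X) a, f (x • a) = of p x * f a) (s : MonoidAlgebra ℤ X) (a : A) :
    f (groupRingAct s a) = toCompleted p s * f a := by
  induction s using MonoidAlgebra.induction_linear with
  | zero => rw [map_zero, map_zero, zero_mul]; exact map_zero f
  | add s t hs ht => rw [groupRingAct_add, map_add, map_add, hs, ht, add_mul]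
  | single x n =>
    have hsingle : toCompleted p (MonoidAlgebra.single x n) = n • of p x := by
      conv_lhs => rw [← mul_one n, ← smul_eq_mul, ← MonoidAlgebra.smul_single, map_zsmul]
      rfl
    rw [groupRingAct_single, map_zsmul, hf, hsingle, smul_mul_assoc]

variable [TopologicalSpace A] [IsProPModule p X A] [IsTopologicalAddGroup A]
  [CompactSpace A] [T2Space A]

lemma map_smul_of_levelwise_eventually_eq_zero {f : A →+ CompletedGroupAlgebra p X}
    (hf : ∀ (x : X) a, f (x • a) = of p x * f a)
    (h0 : ∀ i, ∀ᶠ a in 𝓝 0, level p i (f a) = 0) (r : CompletedGroupAlgebra p X) (a : A) :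
    f (r • a) = r * f a := by
  refine ext_level fun i => ?_
  obtain ⟨j, hj⟩ := isLimitSMul_smul p r a _ (h0 i)
  obtain ⟨l, hil, hjl⟩ := exists_level_le i j
  obtain ⟨s, hs⟩ := toLevel_surjective p l (level p l r)
  have h : level p i (f (r • a - groupRingAct s a)) = 0 :=
    hj s (toLevel_eq_of_le p hjl.1 hjl.2 hs)
  rw [map_sub, map_sub, sub_eq_zero, map_groupRingAct hf, map_mul] at h
  rw [h, map_mul]
  exact congrArg (· * level p i (f a)) (toLevel_eq_of_le p hil.1 hil.2 hs)

end CompletedGroupAlgebra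

lemma finite_levelAlgebra (p : ℕ) [NeZero p] {X : Type*} [CommGroup X] [TopologicalSpace X]
    [CompactSpace X] [SeparatelyContinuousMul X] (i : ℕ × OpenNormalSubgroup X) :
    Finite (LevelAlgebra p X i) := by
  have : Finite (X ⧸ i.2.toSubgroup) := i.2.toSubgroup.quotient_finite_of_isOpen i.2.isOpen
  have : NeZero (p ^ i.1) := ⟨pow_ne_zero _ (NeZero.ne p)⟩
  exact Finite.of_injective _ (DFunLike.coe_injective.comp MonoidAlgebra.coeff_injective)

lemma isPGroup_levelAlgebra (p : ℕ) {X : Type*} [CommGroup X] [TopologicalSpace X]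
    (i : ℕ × OpenNormalSubgroup X) : IsPGroup p (Multiplicative (LevelAlgebra p X i)) :=
  isPGroup_iff_pow_pow_eq_one.mpr fun a => ⟨i.1, by
    refine Multiplicative.toAdd.injective ?_
    rw [toAdd_pow, toAdd_one, ← Nat.cast_smul_eq_nsmul (ZMod (p ^ i.1)), ZMod.natCast_self,
      zero_smul]⟩

namespace AbelianizedAlgebra

variable (p : ℕ) {F : Type*} [Group F] [TopologicalSpace F] [IsTopologicalGroup F]

/-- The canonical homomorphism `F → ℤ_p[[F / F']]ˣ`, with values in the ring. -/
def of : F →* AbelianizedAlgebra F p :=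
  (CompletedGroupAlgebra.of p).comp (QuotientGroup.mk' (derivedSubgroup F))

variable {p}

lemma of_sub_one (x : F) : of p x - 1 = xiElement p x := rfl

lemma of_eq_one {a : F} (ha : a ∈ derivedSubgroup F) : of p a = 1 := by
  change CompletedGroupAlgebra.of p (QuotientGroup.mk a) = 1
  rw [(QuotientGroup.eq_one_iff a).mpr ha, map_one]

lemma level_of (i : ℕ × OpenNormalSubgroup (TopologicalAbelianization F)) (x : F) :
    CompletedGroupAlgebra.level p i (of p x) =
      MonoidAlgebra.single (QuotientGroup.mk (QuotientGroup.mk x)) 1 :=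
  CompletedGroupAlgebra.level_of i _

lemma isLocallyConstant_level_of (i : ℕ × OpenNormalSubgroup (TopologicalAbelianization F)) :
    IsLocallyConstant fun x : F => CompletedGroupAlgebra.level p i (of p x) := by
  have h := ((isLocallyConstant_quotientGroupMk i.2.isOpen).comp fun q =>
    (MonoidAlgebra.single q 1 : LevelAlgebra p _ i)).comp_continuous
      (QuotientGroup.continuous_mk (N := derivedSubgroup F))
  exact (funext (level_of i) : (fun x : F => CompletedGroupAlgebra.level p i (of p x)) = _) ▸ h

lemma isCrossedHom_levelMap {i j : ℕ × OpenNormalSubgroup (TopologicalAbelianization F)}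
    (hn : i.1 ≤ j.1) (hN : j.2 ≤ i.2) {D : F → LevelAlgebra p (TopologicalAbelianization F) j}
    (hD : IsCrossedHom ((CompletedGroupAlgebra.level p j).toMonoidHom.comp (of p)) D) :
    IsCrossedHom ((CompletedGroupAlgebra.level p i).toMonoidHom.comp (of p))
      fun x => levelMap p hn hN (D x) := by
  have hχ : (levelMap p hn hN).toMonoidHom.comp
      ((CompletedGroupAlgebra.level p j).toMonoidHom.comp (of p)) =
      (CompletedGroupAlgebra.level p i).toMonoidHom.comp (of p) :=
    MonoidHom.ext fun x => CompletedGroupAlgebra.levelMap_level hn hN (of p x)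
  exact hχ ▸ hD.map (levelMap p hn hN)

end AbelianizedAlgebra

namespace IsFreeMetabelianProP

variable {p : ℕ} [Fact p.Prime] {ι : Type*} [Finite ι] {F : Type u} [Group F] [TopologicalSpace F]
  [IsTopologicalGroup F] [CompactSpace F] [T2Space F] [TotallyDisconnectedSpace F] [IsProP p F]
  [IsMetabelianGroup F] {g : ι → F}

open CompletedGroupAlgebra (level)

lemma exists_isCrossedHom_completed (hg : IsFreeMetabelianProP p g)
    (c : ι → AbelianizedAlgebra F p) :
    ∃ D : F → AbelianizedAlgebra F p, IsCrossedHom (AbelianizedAlgebra.of p) D ∧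
      (∀ i, IsLocallyConstant fun x => level p i (D x)) ∧ ∀ i, D (g i) = c i := by
  have hlevel (i : ℕ × OpenNormalSubgroup (TopologicalAbelianization F)) :
      ∃ D : F → LevelAlgebra p (TopologicalAbelianization F) i,
        IsCrossedHom ((level p i).toMonoidHom.comp (AbelianizedAlgebra.of p)) D ∧
          IsLocallyConstant D ∧ ∀ k, D (g k) = level p i (c k) := by
    have := finite_levelAlgebra p i
    exact hg.exists_isCrossedHom (isPGroup_levelAlgebra p i)
      (AbelianizedAlgebra.isLocallyConstant_level_of i) _
  choose D hD hDlc hDg using hlevel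
  have hcompat {i j : ℕ × OpenNormalSubgroup (TopologicalAbelianization F)} (hn : i.1 ≤ j.1)
      (hN : j.2 ≤ i.2) : (fun x => levelMap p hn hN (D j x)) = D i := by
    refine (AbelianizedAlgebra.isCrossedHom_levelMap hn hN (hD j)).eq_of_dense_closure (hD i)
      ((hDlc j).comp _) (hDlc i) hg.dense_closure_range ?_
    rintro _ ⟨k, rfl⟩
    beta_reduce
    rw [hDg, hDg, CompletedGroupAlgebra.levelMap_level]
  exact ⟨fun x => ⟨fun i => D i x, fun _ _ hn hN => congrFun (hcompat hn hN) x⟩,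
    fun x y => CompletedGroupAlgebra.ext_level fun i => hD i x y, hDlc,
    fun k => CompletedGroupAlgebra.ext_level fun i => hDg i k⟩

end IsFreeMetabelianProP

namespace IsFreeMetabelianProP

variable {p : ℕ} [Fact p.Prime] {ι : Type*} {F : Type u} [Group F] [TopologicalSpace F]
  [IsTopologicalGroup F] [CompactSpace F] [T2Space F] [TotallyDisconnectedSpace F] [IsProP p F]
  [IsMetabelianGroup F] {g : ι → F}

open CompletedGroupAlgebra (level)

section FoxDerivative

variable [Finite ι] [DecidableEq ι] (hg : IsFreeMetabelianProP p g) (k : ι)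

/-- The Fox derivative `∂/∂g_k`, with coefficients reduced modulo `F'`. -/
def foxDerivative : F → AbelianizedAlgebra F p :=
  (hg.exists_isCrossedHom_completed (Pi.single k 1)).choose

lemma isCrossedHom_foxDerivative :
    IsCrossedHom (AbelianizedAlgebra.of p) (hg.foxDerivative k) :=
  (hg.exists_isCrossedHom_completed (Pi.single k 1)).choose_spec.1

lemma isLocallyConstant_level_foxDerivative
    (i : ℕ × OpenNormalSubgroup (TopologicalAbelianization F)) :
    IsLocallyConstant fun x => level p i (hg.foxDerivative k x) :=
  (hg.exists_isCrossedHom_completed (Pi.single k 1)).choose_spec.2.1 i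

lemma foxDerivative_generator (i : ι) :
    hg.foxDerivative k (g i) = (Pi.single k 1 : ι → AbelianizedAlgebra F p) i :=
  (hg.exists_isCrossedHom_completed (Pi.single k 1)).choose_spec.2.2 i

/-- The restriction of the Fox derivative `∂/∂g_k` to `F'`. -/
def foxLinearMap : DerivedModule F →ₗ[AbelianizedAlgebra F p] AbelianizedAlgebra F p :=
  let f : DerivedModule F →+ AbelianizedAlgebra F p :=
    AddMonoidHom.mk' (fun a => hg.foxDerivative k a.toMul) fun a b => by
      rw [toMul_add, Subgroup.coe_mul, hg.isCrossedHom_foxDerivative k,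
        AbelianizedAlgebra.of_eq_one b.toMul.2, one_smul]
  { f with
    map_smul' := CompletedGroupAlgebra.map_smul_of_levelwise_eventually_eq_zero (f := f)
      (fun x a => by
        induction x using QuotientGroup.induction_on with | H x => ?_
        exact (hg.isCrossedHom_foxDerivative k).map_conj x
          (AbelianizedAlgebra.of_eq_one a.toMul.2))
      fun i => by
        have hlc := (hg.isLocallyConstant_level_foxDerivative k i).comp_continuous
          (continuous_subtype_val : Continuous fun a : derivedSubgroup F => (a : F))
        filter_upwards [hlc.eventually_eq 1] with a ha
        refine ha.trans ?_
        change level p i (hg.foxDerivative k 1) = 0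
        rw [(hg.isCrossedHom_foxDerivative k).map_one, map_zero] }

lemma foxLinearMap_apply (a : DerivedModule F) :
    hg.foxLinearMap k a = hg.foxDerivative k a.toMul := rfl

lemma foxLinearMap_derivedCommutator (i j : ι) :
    hg.foxLinearMap k (derivedCommutator (g i) (g j)) =
      xiElement p (g j) * (Pi.single k 1 : ι → AbelianizedAlgebra F p) i -
        xiElement p (g i) * (Pi.single k 1 : ι → AbelianizedAlgebra F p) j := by
  rw [← foxDerivative_generator, ← foxDerivative_generator]
  exact (hg.isCrossedHom_foxDerivative k).map_commutator (g i) (g j)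

end FoxDerivative

section FoxFormula

variable [Fintype ι] [DecidableEq ι] (hg : IsFreeMetabelianProP p g)

lemma eq_sum_level_foxDerivative_smul (i : ℕ × OpenNormalSubgroup (TopologicalAbelianization F))
    {M : Type*} [AddCommGroup M] [Module (LevelAlgebra p (TopologicalAbelianization F) i) M]
    {K : F → M} (hK : IsCrossedHom ((level p i).toMonoidHom.comp (AbelianizedAlgebra.of p)) K)
    (hKlc : IsLocallyConstant K) (x : F) :
    K x = ∑ k, level p i (hg.foxDerivative k x) • K (g k) :=
  hK.eq_sum_smul_of_dense_closure hg.dense_closure_range hKlc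
    (fun k => (hg.isCrossedHom_foxDerivative k).map (level p i))
    (fun k => hg.isLocallyConstant_level_foxDerivative k i)
    (fun k l => by
      simp only [foxDerivative_generator, Pi.single_apply, apply_ite (level p i), map_one,
        map_zero]) x

lemma sum_foxDerivative_mul_xiElement (x : F) :
    ∑ k, hg.foxDerivative k x * xiElement p (g k) = xiElement p x := by
  refine CompletedGroupAlgebra.ext_level fun i => ?_
  have hlc : IsLocallyConstant fun x : F => level p i (AbelianizedAlgebra.of p x - 1) := by
    simp only [map_sub, map_one]
    exact (AbelianizedAlgebra.isLocallyConstant_level_of i).comp (· - 1)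
  have h := hg.eq_sum_level_foxDerivative_smul i
    ((IsCrossedHom.sub_one (AbelianizedAlgebra.of p)).map (level p i)) hlc x
  rw [map_sum]
  simp only [map_mul]
  exact h.symm

end FoxFormula

end IsFreeMetabelianProP

/-! ### The derived module -/

lemma derivedSubgroup_le_ker {F Q : Type*} [Group F] [TopologicalSpace F] [IsTopologicalGroup F]
    [CommGroup Q] {φ : F →* Q} (hφ : IsLocallyConstant φ) : derivedSubgroup F ≤ φ.ker :=
  Subgroup.topologicalClosure_minimal _ (Abelianization.commutator_subset_ker φ)
    (hφ.isClosed_fiber 1)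

lemma derivedCommutator_self {F : Type*} [Group F] [TopologicalSpace F] [IsTopologicalGroup F]
    (x : F) : derivedCommutator x x = 0 :=
  Additive.toMul.injective <| Subtype.ext <| show x⁻¹ * x⁻¹ * x * x = 1 by group

section Images

variable {F : Type*} [Group F] [TopologicalSpace F] [IsTopologicalGroup F]

/-- The image in `F / F'` of an open normal subgroup of `F`. -/
def abelianizedOpenNormalSubgroup (N : OpenNormalSubgroup F) :
    OpenNormalSubgroup (TopologicalAbelianization F) :=
  ⟨⟨N.toSubgroup.map (QuotientGroup.mk' _), QuotientGroup.isOpenMap_coe _ N.isOpen⟩,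
    N.isNormal'.map _ (QuotientGroup.mk'_surjective _)⟩

/-- The projection `F / N → (F / F') / (N F' / F')`. -/
def abelianizedQuotientMap (N : OpenNormalSubgroup F) : F ⧸ N.toSubgroup →*
    TopologicalAbelianization F ⧸ (abelianizedOpenNormalSubgroup N).toSubgroup :=
  QuotientGroup.map _ _ (QuotientGroup.mk' (derivedSubgroup F)) (Subgroup.le_comap_map _ _)

lemma abelianizedQuotientMap_surjective (N : OpenNormalSubgroup F) :
    Function.Surjective (abelianizedQuotientMap N) :=
  QuotientGroup.map_surjective_of_surjective _ _ _
    (QuotientGroup.mk_surjective.comp (QuotientGroup.mk'_surjective _)) _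

lemma exists_mem_derivedSubgroup_of_mem_ker {N : OpenNormalSubgroup F} {q : F ⧸ N.toSubgroup}
    (hq : q ∈ (abelianizedQuotientMap N).ker) :
    ∃ a ∈ derivedSubgroup F, (QuotientGroup.mk a : F ⧸ N.toSubgroup) = q := by
  obtain ⟨x, rfl⟩ := QuotientGroup.mk_surjective q
  obtain ⟨y, hy, hyx⟩ := (QuotientGroup.eq_one_iff _).mp (MonoidHom.mem_ker.mp hq)
  refine ⟨y⁻¹ * x, QuotientGroup.eq.mp hyx, ?_⟩
  rw [QuotientGroup.mk_mul, QuotientGroup.mk_inv, (QuotientGroup.eq_one_iff y).mpr hy, inv_one,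
    one_mul]

lemma commute_of_mem_ker_abelianizedQuotientMap [T2Space F] [IsMetabelianGroup F]
    {N : OpenNormalSubgroup F} (q r : F ⧸ N.toSubgroup)
    (hq : q ∈ (abelianizedQuotientMap N).ker) (hr : r ∈ (abelianizedQuotientMap N).ker) :
    q * r = r * q := by
  obtain ⟨a, ha, rfl⟩ := exists_mem_derivedSubgroup_of_mem_ker hq
  obtain ⟨b, hb, rfl⟩ := exists_mem_derivedSubgroup_of_mem_ker hr
  exact congrArg (QuotientGroup.mk ∘ Subtype.val)
    (mul_comm (⟨a, ha⟩ : derivedSubgroup F) ⟨b, hb⟩)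

end Images

namespace IsFreeMetabelianProP

variable {p : ℕ} [Fact p.Prime] {ι : Type*} {F : Type u} [Group F] [TopologicalSpace F]
  [IsTopologicalGroup F] [CompactSpace F] [T2Space F] [TotallyDisconnectedSpace F] [IsProP p F]
  [IsMetabelianGroup F] {g : ι → F}

open CompletedGroupAlgebra (level)

lemma eq_zero_of_foxLinearMap_eq_zero [Finite ι] [DecidableEq ι] (hg : IsFreeMetabelianProP p g)
    {a : DerivedModule F} (ha : ∀ k, hg.foxLinearMap k a = 0) : a = 0 := by
  have := Fintype.ofFinite ι
  refine Additive.toMul.injective (Subtype.ext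
    (eq_one_of_forall_mem_openNormalSubgroup fun N => ?_))
  obtain ⟨n, hn⟩ := IsProP.index_eq_pow (p := p) N
  obtain ⟨M, _, _, K, hK, hK0⟩ := exists_isCrossedHom_eq_one_of_mem_ker (m := p ^ n)
    (abelianizedQuotientMap_surjective N)
    (fun q hq r hr => commute_of_mem_ker_abelianizedQuotientMap q r hq hr)
    fun q _ => by rw [← hn, Subgroup.index]; exact pow_card_eq_one'
  have hKF : IsCrossedHom ((level p (n, abelianizedOpenNormalSubgroup N)).toMonoidHom.comp
      (AbelianizedAlgebra.of p)) fun x : F => K (QuotientGroup.mk x) := fun x y => by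
    have hχ : level p (n, abelianizedOpenNormalSubgroup N) (AbelianizedAlgebra.of p y) =
      _ := AbelianizedAlgebra.level_of _ y
    change _ = level p (n, abelianizedOpenNormalSubgroup N) (AbelianizedAlgebra.of p y) • _ + _
    rw [hχ]
    exact hK (QuotientGroup.mk x) (QuotientGroup.mk y)
  refine (QuotientGroup.eq_one_iff _).mp (hK0 _ ?_ ?_)
  · exact congrArg QuotientGroup.mk ((QuotientGroup.eq_one_iff _).mpr a.toMul.2)
  · rw [hg.eq_sum_level_foxDerivative_smul _ hKF
      ((isLocallyConstant_quotientGroupMk N.isOpen).comp K)]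
    refine Finset.sum_eq_zero fun k _ => ?_
    rw [← foxLinearMap_apply, ha, map_zero, zero_smul]

end IsFreeMetabelianProP

namespace IsFreeMetabelianProP

variable {p : ℕ} [Fact p.Prime] {ι : Type*} {F : Type u} [Group F] [TopologicalSpace F]
  [IsTopologicalGroup F] [CompactSpace F] [T2Space F] [TotallyDisconnectedSpace F] [IsProP p F]
  [IsMetabelianGroup F] {g : ι → F}

section NonZeroDivisor

variable [Finite ι] (hg : IsFreeMetabelianProP p g) (j : ι)

include hg in
lemma exists_dvd_orderOf_generator (k : ℕ) :
    ∃ N : OpenNormalSubgroup (TopologicalAbelianization F), p ^ k ∣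
      orderOf (QuotientGroup.mk (QuotientGroup.mk (g j)) :
        TopologicalAbelianization F ⧸ N.toSubgroup) := by
  have : NeZero (p ^ k) := ⟨pow_ne_zero k (Fact.out : p.Prime).ne_zero⟩
  have : IsMetabelianGroup (Multiplicative (ZMod (p ^ k))) := ⟨fun a _ b _ => mul_comm a b⟩
  obtain ⟨φ, hφ, hφg⟩ := hg.exists_lift (G := Multiplicative (ZMod (p ^ k)))
    (IsPGroup.of_card (n := k) ((Nat.card_congr Multiplicative.toAdd).trans (Nat.card_zmod _)))
    fun _ => .ofAdd 1
  let ψ := QuotientGroup.lift (derivedSubgroup F) φ (derivedSubgroup_le_ker hφ)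
  have hψ : IsOpen (ψ.ker : Set (TopologicalAbelianization F)) :=
    isQuotientMap_quotient_mk'.isOpen_preimage.mp (hφ.isOpen_fiber 1)
  refine ⟨⟨⟨ψ.ker, hψ⟩, ψ.normal_ker⟩, ?_⟩
  have hord : orderOf (ψ (QuotientGroup.mk (g j))) = p ^ k := by
    rw [show ψ (QuotientGroup.mk (g j)) = .ofAdd 1 from hφg j, orderOf_ofAdd_eq_addOrderOf,
      ZMod.addOrderOf_one]
  exact hord.symm.dvd.trans (orderOf_map_dvd (QuotientGroup.kerLift ψ) _)

include hg in
lemma xiElement_mem_nonZeroDivisors :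
    xiElement p (g j) ∈ nonZeroDivisors (AbelianizedAlgebra F p) := by
  refine CompletedGroupAlgebra.of_sub_one_mem_nonZeroDivisors (Fact.out : p.Prime).pos
    (fun N => ?_) (hg.exists_dvd_orderOf_generator j)
  have hlc := (isLocallyConstant_quotientGroupMk N.isOpen).comp_continuous
    (QuotientGroup.continuous_mk (N := derivedSubgroup F))
  have hP : IsPGroup p (TopologicalAbelianization F ⧸ N.toSubgroup) :=
    IsProP.isPGroup_of_surjective (f := (QuotientGroup.mk' _).comp (QuotientGroup.mk' _)) hlc
      ((QuotientGroup.mk'_surjective _).comp (QuotientGroup.mk'_surjective _))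
  obtain ⟨e, he⟩ := hP.exists_pow_pow_eq_one (QuotientGroup.mk (QuotientGroup.mk (g j)))
  exact ⟨e, (QuotientGroup.eq_one_iff _).mp he⟩

end NonZeroDivisor

lemma xiElement_smul_injective [Finite ι] (hg : IsFreeMetabelianProP p g) (j : ι) :
    Function.Injective fun a : DerivedModule F => xiElement p (g j) • a := by
  classical
  refine (injective_iff_map_eq_zero (LinearMap.lsmul (AbelianizedAlgebra F p) (DerivedModule F)
    (xiElement p (g j)))).mpr fun a ha => hg.eq_zero_of_foxLinearMap_eq_zero fun k => ?_
  refine (mul_left_mem_nonZeroDivisors_eq_zero_iff (hg.xiElement_mem_nonZeroDivisors j)).mp ?_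
  rw [← smul_eq_mul, ← map_smul]
  exact (congrArg _ ha).trans (map_zero _)

lemma linearIndependent_derivedCommutator [Finite ι] (hg : IsFreeMetabelianProP p g) (j : ι) :
    LinearIndependent (AbelianizedAlgebra F p)
      fun i : {i // i ≠ j} => derivedCommutator (g i) (g j) := by
  classical
  have := Fintype.ofFinite ι
  refine Fintype.linearIndependent_iff.mpr fun r hr k => ?_
  refine (mul_right_mem_nonZeroDivisors_eq_zero_iff (hg.xiElement_mem_nonZeroDivisors j)).mp ?_
  have hk := congrArg (hg.foxLinearMap k) hr
  simpa [foxLinearMap_derivedCommutator, Pi.single_apply, k.2.symm, Subtype.coe_inj] using hk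

lemma xiElement_smul_eq_sum [Fintype ι] [DecidableEq ι] (hg : IsFreeMetabelianProP p g) (j : ι)
    (a : DerivedModule F) : xiElement p (g j) • a =
      ∑ i, hg.foxLinearMap i a • derivedCommutator (g i) (g j) := by
  have hsum : ∑ i, hg.foxLinearMap i a * xiElement p (g i) = 0 := by
    refine (hg.sum_foxDerivative_mul_xiElement a.toMul).trans ?_
    rw [← AbelianizedAlgebra.of_sub_one, AbelianizedAlgebra.of_eq_one a.toMul.2, sub_self]
  refine sub_eq_zero.mp (hg.eq_zero_of_foxLinearMap_eq_zero fun k => ?_)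
  calc hg.foxLinearMap k (xiElement p (g j) • a -
        ∑ i, hg.foxLinearMap i a • derivedCommutator (g i) (g j))
      = xiElement p (g j) * hg.foxLinearMap k a - (hg.foxLinearMap k a * xiElement p (g j) -
          (∑ i, hg.foxLinearMap i a * xiElement p (g i)) *
            (Pi.single k 1 : ι → AbelianizedAlgebra F p) j) := by
        simp [foxLinearMap_derivedCommutator, Pi.single_apply, mul_sub]
    _ = 0 := by rw [hsum]; ring

end IsFreeMetabelianProP

end

theorem mainTheorem5 (p : ℕ) [Fact p.Prime] (d : ℕ) (hd : 2 ≤ d)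
    {F : Type u} [Group F] [TopologicalSpace F] [IsTopologicalGroup F] [CompactSpace F]
    [T2Space F] [TotallyDisconnectedSpace F] [IsProP p F] [IsMetabelianGroup F]
    (g : Fin d → F) (hg : IsFreeMetabelianProP p g) :
    (∃ e : DerivedModule F ≃ₗ[AbelianizedAlgebra F p] xiMultiples p (g ⟨d - 1, by omega⟩),
      ∀ a : DerivedModule F, (e a : DerivedModule F) = xiElement p (g ⟨d - 1, by omega⟩) • a) ∧
    LinearIndependent (AbelianizedAlgebra F p) (lastCommutators hd g) ∧
    xiMultiples p (g ⟨d - 1, by omega⟩) ≤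
      ⨆ i : Fin (d - 1), Submodule.span (AbelianizedAlgebra F p) {lastCommutators hd g i} := by
  let last : Fin d := ⟨d - 1, by omega⟩
  refine ⟨⟨LinearEquiv.ofInjective _ (hg.xiElement_smul_injective last), fun _ => rfl⟩, ?_, ?_⟩
  · let castLast (i : Fin (d - 1)) : {i // i ≠ last} :=
      ⟨i.castLE (Nat.sub_le d 1), fun h => i.2.ne (congrArg Fin.val h)⟩
    exact (hg.linearIndependent_derivedCommutator last).comp castLast fun i k h =>
      Fin.castLE_injective (Nat.sub_le d 1) (congrArg Subtype.val h)
  · rintro _ ⟨a, rfl⟩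
    rw [LinearMap.lsmul_apply, hg.xiElement_smul_eq_sum last a]
    refine Submodule.sum_mem _ fun i _ => Submodule.smul_mem _ _ ?_
    obtain hi | rfl : (i : ℕ) < d - 1 ∨ i = last := by
      rw [Fin.ext_iff]
      change _ ∨ (i : ℕ) = d - 1
      omega
    · exact Submodule.mem_iSup_of_mem ⟨i, hi⟩ (Submodule.mem_span_singleton_self _)
    · exact derivedCommutator_self (g last) ▸ Submodule.zero_mem _
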